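/- \textbf{Theorem (Weil's Galois descent theorem for morphisms).} Let $K$ be a perfect field, $L/K$ a finite Galois extension with group $\Gamma=\mathrm{Gal}(L/K)$, and $C$ an algebraic closure of $K$ containing $L$. For $k\in\{K,L\}$, an (affine algebraic) variety defined over $k$ is a Zariski closed subset $X\subset C^n$, not necessarily irreducible, whose ideal in $C[z_1,\dots,z_n]$ is generated by polynomials with coefficients in $k$. A morphism defined over $k$ is given by polynomials with coefficients in $k$. A rational map $X\dashrightarrow Y$ defined over $k$ is given by quotients of polynomials with coefficients in $k$ whose denominators are nonzero on a Zariski dense subset of $X$; two of them are equal if they agree wherever both are defined. A birational isomorphism defined over $k$ is a rational map defined over $k$ that has an inverse rational map defined over $k$. For $\sigma\in\Gamma$, $P^\sigma$ and $f^\sigma$ denote the result of applying $\sigma$ to the coefficients of a polynomial $P$ or of a (rational) map $f$ over $L$, and $X^\sigma$ is the zero locus of the polynomials $P^\sigma$, where $P$ runs through the polynomials over $L$ that vanish on $X$. Let $X$ be a variety defined over $L$, let $Z$ be a variety defined over $K$, and let $\varphi:X\to Z$ be a morphism defined over $L$. Suppose that there is a Galois descent datum for $\varphi$ with respect to $L/K$,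 that is, a family $\{f_\sigma:X\dashrightarrow X^\sigma\}_{\sigma\in\Gamma}$ of birational isomorphisms defined over $L$ such that (i) $\varphi=\varphi^\sigma\circ f_\sigma$ for every $\sigma\in\Gamma$, and (ii) $f_{\sigma\tau}=f_\tau^{\sigma}\circ f_\sigma$ for all $\sigma,\tau\in\Gamma$. Then there exist a variety $Y$ and a morphism $\Lambda:Y\to Z$, both defined over $K$, and a birational isomorphism $R:X\dashrightarrow Y$ defined over $L$, such that $\Lambda\circ R=\varphi$ and $R=R^\sigma\circ f_\sigma$ for every $\sigma\in\Gamma$. If $X$ is irreducible, then so is $Y$. -/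

import Mathlib

namespace WeilDescent

open MvPolynomial

/-! Affine algebraic varieties are Zariski closed subsets of `Cⁿ` (points over an algebraically
closed field `C`), not necessarily irreducible. `k` is a field of coefficients inside `C`. -/

section Varieties

variable {C : Type*} [Field C] {n : ℕ}

/-- `X ⊆ Cⁿ` is the locus of common zeros of a collection of polynomials. -/
def IsAlgebraicSet (X : Set (Fin n → C)) : Prop :=
  ∃ I : Ideal (MvPolynomial (Fin n) C), X = zeroLocus C I

/-- The ideal of `X` in `C[z₁, …, zₙ]` is generated by polynomials with coefficients in `k`. -/
def IsDefinedOver (k : Type*) [Field k] [Algebra k C] (X : Set (Fin n → C)) : Prop :=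
  ∃ S : Set (MvPolynomial (Fin n) k),
    vanishingIdeal C X = Ideal.span (MvPolynomial.map (algebraMap k C) '' S)

/-- An affine algebraic variety in `Cⁿ` that is defined over `k`. -/
def IsVarietyOver (k : Type*) [Field k] [Algebra k C] (X : Set (Fin n → C)) : Prop :=
  IsAlgebraicSet X ∧ IsDefinedOver k X

/-- Irreducibility: the ideal of `X` is prime (so the empty set is not irreducible). -/
def IsIrred (X : Set (Fin n → C)) : Prop :=
  (vanishingIdeal C X).IsPrime

/-- `U` is a Zariski dense subset of `X`. -/
def IsDenseIn (U X : Set (Fin n → C)) : Prop :=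
  U ⊆ X ∧ ∀ P : MvPolynomial (Fin n) C,
    (∀ x ∈ U, eval x P = 0) → ∀ x ∈ X, eval x P = 0

/-- The conjugate variety `X^σ`: the zero locus of the polynomials `P^σ`, for all `P` with
coefficients in `L` that vanish on `X`. -/
def conjVariety {K L : Type*} [Field K] [Field L] [Algebra K L] [Algebra L C]
    (σ : L ≃ₐ[K] L) (X : Set (Fin n → C)) : Set (Fin n → C) :=
  {y | ∀ P : MvPolynomial (Fin n) L, (∀ x ∈ X, aeval x P = 0) →
    aeval y (MvPolynomial.map (σ : L →+* L) P) = 0}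

end Varieties

/-- The tuple of fractions `(num₁ / den, …, numₘ / den)` with coefficients in `k`. -/
structure RatTuple (k : Type*) [Field k] (n m : ℕ) where
  num : Fin m → MvPolynomial (Fin n) k
  den : MvPolynomial (Fin n) k

namespace RatTuple

/-- A tuple of polynomials, as a tuple of fractions with denominator `1`. -/
noncomputable def ofPoly {k : Type*} [Field k] {n m : ℕ} (p : Fin m → MvPolynomial (Fin n) k) :
    RatTuple k n m :=
  ⟨p, 1⟩

/-- The identity `(z₁, …, zₙ)`. -/
noncomputable def id (k : Type*) [Field k] (n : ℕ) : RatTuple k n n :=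
  ofPoly fun i => X i

/-- `f^σ`: apply `σ` to all coefficients. -/
noncomputable def conj {K L : Type*} [Field K] [Field L] [Algebra K L] {n m : ℕ}
    (σ : L ≃ₐ[K] L) (f : RatTuple L n m) : RatTuple L n m :=
  ⟨fun j => MvPolynomial.map (σ : L →+* L) (f.num j), MvPolynomial.map (σ : L →+* L) f.den⟩

variable {C : Type*} [Field C] {n m : ℕ}

/-- The points of `Cⁿ` at which the fractions are defined. -/
def dom {k : Type*} [Field k] [Algebra k C] (f : RatTuple k n m) : Set (Fin n → C) :=
  {x | aeval x f.den ≠ 0}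

/-- The value at a point (meaningful on `dom`). -/
noncomputable def val {k : Type*} [Field k] [Algebra k C] (f : RatTuple k n m)
    (x : Fin n → C) : Fin m → C :=
  fun j => aeval x (f.num j) / aeval x f.den

end RatTuple

section Maps

variable {C : Type*} [Field C] {n m l : ℕ}

/-- The polynomials `p` with coefficients in `k` define a morphism `X → Y` over `k`. -/
def IsMorphism {k : Type*} [Field k] [Algebra k C] (X : Set (Fin n → C)) (Y : Set (Fin m → C))
    (p : Fin m → MvPolynomial (Fin n) k) : Prop :=
  ∀ x ∈ X, (fun j => aeval x (p j)) ∈ Y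

/-- `f` represents a rational map `X ⇢ Y` over `k`: it is defined on a dense open subset of `X`
and takes its values in `Y`. -/
def IsRationalMap {k : Type*} [Field k] [Algebra k C] (X : Set (Fin n → C))
    (Y : Set (Fin m → C)) (f : RatTuple k n m) : Prop :=
  IsDenseIn (X ∩ f.dom) X ∧ ∀ x ∈ X ∩ f.dom, f.val x ∈ Y

/-- `h = g ∘ f` as rational maps on `X`: the composite is defined on a dense open subset of `X`,
and it agrees with `h` wherever both are defined. -/
def EqComp {k₁ k₂ k₃ : Type*} [Field k₁] [Field k₂] [Field k₃]
    [Algebra k₁ C] [Algebra k₂ C] [Algebra k₃ C] (X : Set (Fin n → C))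
    (h : RatTuple k₁ n l) (g : RatTuple k₂ m l) (f : RatTuple k₃ n m) : Prop :=
  IsDenseIn {x | x ∈ X ∧ x ∈ f.dom ∧ f.val x ∈ g.dom} X ∧
    ∀ x ∈ X, x ∈ f.dom → f.val x ∈ g.dom → x ∈ h.dom → h.val x = g.val (f.val x)

/-- `f` represents a birational isomorphism `X ⇢ Y` over `k`: it has a rational inverse. -/
def IsBirational {k : Type*} [Field k] [Algebra k C] (X : Set (Fin n → C))
    (Y : Set (Fin m → C)) (f : RatTuple k n m) : Prop :=
  IsRationalMap X Y f ∧ ∃ g : RatTuple k m n, IsRationalMap Y X g ∧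
    EqComp X (RatTuple.id k n) g f ∧ EqComp Y (RatTuple.id k m) f g

/-- A Galois descent datum `{f_σ : X ⇢ X^σ}` for the morphism `φ : X → Z`, with respect to `L/K`:
birational isomorphisms over `L` with `φ = φ^σ ∘ f_σ` and `f_{στ} = f_τ^σ ∘ f_σ`. -/
structure IsDescentDatum {K L : Type*} [Field K] [Field L] [Algebra K L] [Algebra L C]
    (X : Set (Fin n → C)) (φ : Fin m → MvPolynomial (Fin n) L)
    (f : (L ≃ₐ[K] L) → RatTuple L n n) : Prop where
  birational : ∀ σ, IsBirational X (conjVariety σ X) (f σ)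
  compat : ∀ σ, EqComp X (RatTuple.ofPoly φ) ((RatTuple.ofPoly φ).conj σ) (f σ)
  cocycle : ∀ σ τ, EqComp X (f (σ * τ)) ((f τ).conj σ) (f σ)

end Maps

end WeilDescent

/-!
Galois descent for a variety with a morphism to a fixed variety, by twisted traces.

A descent datum makes `Gal(L/K)` act semilinearly on the rational functions on `X` over `L`:
`σ · u = u^σ ∘ f_σ`. Condition (ii) says that this is a group action, and it forces `f₁ = id`
(`IsDescentDatum.val_one`). Fix a basis `b` of `L/K`. The traces
`w i k = ∑ σ, σ · (b k * zᵢ) = ∑ σ, σ (b k) * (f_σ)ᵢ` of the coordinate functions are invariant, and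
by condition (i) so are the components of `φ`. Let `R` be the rational map with all these
components, so that `R = R^σ ∘ f_σ` (`IsDescentDatum.eqComp_linComb`), and let `Y` be the Zariski
closure of its image. Three observations finish the proof.

* With the basis `c` dual to `b` for the trace form, `∑ k, c k * σ (b k)` is `1` for `σ = 1` and `0`
  otherwise (`sum_traceDual_mul_conj`), so `zᵢ = ∑ k, c k * w i k`. Thus `R` has a linear left
  inverse, and it is birational onto `Y` (`isBirational_zariskiClosure_image`), whether or not `X`
  is irreducible. No generators of the field, or ring, of invariants have to be found.
* Some of the coordinates on `Y` are the components of `φ`, so `Λ` is a coordinate projection.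
* Since `X^σ` consists of the conjugates of the points of `X`, the relation `R = R^σ ∘ f_σ` shows
  that the ideal of `Y` is stable under `Gal(C/K)`
  (`isDefinedOver_zariskiClosure_image`). As `K` is perfect, `C/K` is Galois, and a stable ideal is
  generated by polynomials over `K` (`eq_span_of_galois_stable`); this is again an expansion in a
  trace dual basis, now applied to the coefficients of a polynomial.

Identities between rational maps are checked on a dense subset and extended by clearing
denominators (`IsDenseIn.eval_val_eq_zero`).
-/

namespace WeilDescent

open MvPolynomial

/-! ### Galois descent for ideals of polynomials -/

section Galois

variable {K L : Type*} [Field K] [Field L] [Algebra K L] [FiniteDimensional K L] [IsGalois K L]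

/-- Expansion of an element of a finite Galois extension in the basis dual to `b` under the trace
form, the traces being written as sums of conjugates. -/
theorem sum_traceDual_mul_sum_conj {ι : Type*} [Fintype ι] [DecidableEq ι]
    (b : Module.Basis ι K L) (x : L) :
    ∑ k, b.traceDual k * ∑ g : L ≃ₐ[K] L, g (b k) * g x = x := by
  conv_rhs => rw [← b.traceDual.sum_repr x]
  refine Finset.sum_congr rfl fun k _ => ?_
  rw [b.traceDual_repr_apply, Algebra.traceForm_apply, Algebra.smul_def,
    trace_eq_sum_automorphisms, mul_comm]
  simp only [map_mul, mul_comm]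

/-- The matrices `(g (b k))` and `(g (b.traceDual k))` are inverse to each other. This is
the row of `1` in their product; the other rows are its conjugates. -/
theorem sum_traceDual_mul_conj {ι : Type*} [Fintype ι] [DecidableEq ι]
    [DecidableEq (L ≃ₐ[K] L)] (b : Module.Basis ι K L) (g : L ≃ₐ[K] L) :
    ∑ k, b.traceDual k * g (b k) = if g = 1 then 1 else 0 := by
  -- Automorphisms of `L` are linearly independent over `L`, and both sides are the coefficients
  -- of one and the same combination, the identity.
  have hli : LinearIndependent L fun g : L ≃ₐ[K] L => (⇑g : L → L) :=
    (linearIndependent_monoidHom L L).comp (fun g : L ≃ₐ[K] L => ((g : L →+* L) : L →* L))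
      fun g g' h => AlgEquiv.ext fun x => DFunLike.congr_fun h x
  rw [Fintype.linearIndependent_iff] at hli
  refine sub_eq_zero.1 (hli (fun g => ∑ k, b.traceDual k * g (b k) - if g = 1 then 1 else 0)
    (funext fun x => ?_) g)
  have h := sum_traceDual_mul_sum_conj b x
  simp_rw [Finset.mul_sum] at h
  rw [Finset.sum_comm] at h
  simp only [Finset.sum_apply, Pi.smul_apply, smul_eq_mul, sub_mul, Finset.sum_sub_distrib,
    Finset.sum_mul, ite_mul, one_mul, zero_mul, Finset.sum_ite_eq', Finset.mem_univ, if_true,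
    AlgEquiv.one_apply, Pi.zero_apply]
  simp only [mul_assoc, h, sub_self]

end Galois

/-- An ideal of `C[z₁, …, zₙ]` that is stable under `Gal(C/K)`, for a Galois extension `C/K`, is
generated by polynomials with coefficients in `K`. -/
theorem eq_span_of_galois_stable {K C ι : Type*} [Field K] [Field C] [Algebra K C] [IsGalois K C]
    (I : Ideal (MvPolynomial ι C))
    (hI : ∀ s : C ≃ₐ[K] C, ∀ P ∈ I, MvPolynomial.map (s : C →+* C) P ∈ I) :
    I = Ideal.span (MvPolynomial.map (algebraMap K C) ''
      {p | MvPolynomial.map (algebraMap K C) p ∈ I}) := by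
  refine le_antisymm (fun P hP => ?_) (Ideal.span_le.2 (by rintro _ ⟨p, hp, rfl⟩; exact hp))
  -- The coefficients of `P` lie in a finite Galois extension `M` of `K`; expand them in a trace
  -- dual basis of `M`.
  let M := FiniteGaloisIntermediateField.adjoin K (P.coeffs : Set C)
  have hM : ∀ a, ∃ y : M, (y : C) = P.coeff a := fun a => by
    by_cases h : P.coeff a = 0
    · exact ⟨0, by simp [h]⟩
    · exact ⟨⟨_, FiniteGaloisIntermediateField.subset_adjoin K (P.coeffs : Set C)
        (coeff_mem_coeffs _ h)⟩, rfl⟩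
  choose y hy using hM
  let b := Module.finBasis K M
  let s : (M ≃ₐ[K] M) → (C ≃ₐ[K] C) := fun g => g.liftNormal C
  have hs : ∀ g (x : M), s g (x : C) = (g x : M) := fun g x => g.liftNormal_commutes C x
  let Q := fun k => ∑ g : M ≃ₐ[K] M, MvPolynomial.C ((g (b k) : M) : C) *
    MvPolynomial.map (s g : C →+* C) P
  have hQI : ∀ k, Q k ∈ I := fun k =>
    Ideal.sum_mem _ fun g _ => Ideal.mul_mem_left _ _ (hI _ _ hP)
  have hQc : ∀ k a, (Q k).coeff a = ((∑ g : M ≃ₐ[K] M, g (b k) * g (y a) : M) : C) := fun k a => by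
    simp only [Q, coeff_sum, coeff_C_mul, coeff_map, ← hy, RingHom.coe_coe, hs]
    simp
  have hQK : ∀ k, ∃ q, MvPolynomial.map (algebraMap K C) q = Q k := fun k => by
    rw [← Set.mem_range, MvPolynomial.mem_range_map_iff_coeffs_subset]
    intro c hc
    obtain ⟨a, -, rfl⟩ := mem_coeffs_iff.1 hc
    refine ⟨Algebra.trace K M (b k * y a), ?_⟩
    rw [hQc, IsScalarTower.algebraMap_apply K M C, trace_eq_sum_automorphisms]
    simp only [map_mul]
    rfl
  have hPQ : P = ∑ k, MvPolynomial.C ((b.traceDual k : M) : C) * Q k := by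
    ext a
    simp only [coeff_sum, coeff_C_mul, hQc]
    rw [← hy]
    refine (congrArg ((↑) : M → C) (sum_traceDual_mul_sum_conj b (y a)).symm).trans ?_
    simp
  rw [hPQ]
  refine Ideal.sum_mem _ fun k _ => Ideal.mul_mem_left _ _ (Ideal.subset_span ?_)
  obtain ⟨q, hq⟩ := hQK k
  exact ⟨q, by rw [Set.mem_ofPred_eq, hq]; exact hQI k, hq⟩

/-! ### Dense subsets and values of fractions -/

section Density

variable {C : Type*} [Field C] {n m l : ℕ}

theorem aeval_eq_eval_map {k ι : Type*} [Field k] [Algebra k C] (x : ι → C)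
    (p : MvPolynomial ι k) : aeval x p = eval x (MvPolynomial.map (algebraMap k C) p) := by
  rw [eval_map, aeval_def]

theorem IsDenseIn.mono {U V X : Set (Fin n → C)} (hU : IsDenseIn U X) (h : U ⊆ V)
    (hV : V ⊆ X) : IsDenseIn V X :=
  ⟨hV, fun P hP => hU.2 P fun x hx => hP x (h hx)⟩

theorem isDenseIn_self (X : Set (Fin n → C)) : IsDenseIn X X :=
  ⟨subset_rfl, fun _ h => h⟩

/-- A dense principal open subset meets every dense subset in a dense subset. -/
theorem IsDenseIn.inter_ne_zero {V X : Set (Fin n → C)} (hV : IsDenseIn V X)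
    {q : MvPolynomial (Fin n) C} (hq : IsDenseIn {x | x ∈ X ∧ eval x q ≠ 0} X) :
    IsDenseIn {x | x ∈ V ∧ eval x q ≠ 0} X := by
  refine ⟨fun x hx => hV.1 hx.1, fun P hP => hq.2 P fun x hx => ?_⟩
  have h := hV.2 (P * q) (fun y hy => by
    by_cases hyq : eval y q = 0
    · simp [hyq]
    · simp [hP y ⟨hy, hyq⟩]) x hx.1
  rw [map_mul] at h
  exact (mul_eq_zero.1 h).resolve_right hx.2

/-- A finite intersection of dense principal open subsets is dense. -/
theorem isDenseIn_forall_ne_zero {ι : Type*} [Fintype ι] {X : Set (Fin n → C)}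
    {q : ι → MvPolynomial (Fin n) C} (hq : ∀ i, IsDenseIn {x | x ∈ X ∧ eval x (q i) ≠ 0} X) :
    IsDenseIn {x | x ∈ X ∧ ∀ i, eval x (q i) ≠ 0} X := by
  classical
  suffices h : ∀ s : Finset ι, IsDenseIn {x | x ∈ X ∧ ∀ i ∈ s, eval x (q i) ≠ 0} X by
    simpa using h Finset.univ
  intro s
  induction s using Finset.induction_on with
  | empty => simpa using isDenseIn_self X
  | insert i s _ ih =>
    refine (ih.inter_ne_zero (hq i)).mono (fun x hx => ⟨hx.1.1, fun j hj => ?_⟩) fun x hx => hx.1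
    rcases Finset.mem_insert.1 hj with rfl | hj
    · exact hx.2
    · exact hx.1.2 j hj

namespace RatTuple

variable {k k' : Type*} [Field k] [Algebra k C] [Field k'] [Algebra k' C]

/-- Clearing denominators in a polynomial expression in the fractions. -/
theorem exists_eval_eq_den_pow_mul (f : RatTuple k n m) (P : MvPolynomial (Fin m) C) :
    ∃ (d : ℕ) (Q : MvPolynomial (Fin n) C), ∀ x ∈ f.dom (C := C),
      eval x Q = aeval x f.den ^ d * eval (f.val x) P := by
  induction P using MvPolynomial.induction_on with
  | C a => exact ⟨0, MvPolynomial.C a, fun x _ => by simp⟩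
  | add p q hp hq =>
    obtain ⟨d, P, hP⟩ := hp
    obtain ⟨e, Q, hQ⟩ := hq
    let D := MvPolynomial.map (algebraMap k C) f.den
    refine ⟨d + e, D ^ e * P + D ^ d * Q, fun x hx => ?_⟩
    simp only [map_add, map_mul, map_pow, hP x hx, hQ x hx, D, ← aeval_eq_eval_map]
    ring
  | mul_X p i hp =>
    obtain ⟨d, P, hP⟩ := hp
    refine ⟨d + 1, P * MvPolynomial.map (algebraMap k C) (f.num i), fun x hx => ?_⟩
    have hx' : aeval x f.den ≠ 0 := hx
    simp only [map_mul, hP x hx, ← aeval_eq_eval_map, eval_X, val]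
    field_simp
    ring

/-- The domain of definition of a composite is a principal open subset. -/
theorem exists_comp_dom (f : RatTuple k n m) (g : RatTuple k' m l) :
    ∃ q : MvPolynomial (Fin n) C, ∀ x, (x ∈ f.dom ∧ f.val x ∈ g.dom) ↔ eval x q ≠ 0 := by
  obtain ⟨d, Q, hQ⟩ := f.exists_eval_eq_den_pow_mul (MvPolynomial.map (algebraMap k' C) g.den)
  refine ⟨MvPolynomial.map (algebraMap k C) f.den * Q, fun x => ?_⟩
  rw [map_mul, ← aeval_eq_eval_map, mul_ne_zero_iff]
  refine and_congr_right fun hx => ?_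
  rw [hQ x hx, ← aeval_eq_eval_map, mul_ne_zero_iff]
  exact ⟨fun h => ⟨pow_ne_zero _ hx, h⟩, fun h => h.2⟩

end RatTuple

section

variable {k k' : Type*} [Field k] [Algebra k C] [Field k'] [Algebra k' C]

theorem IsDenseIn.inter_comp_dom {V X : Set (Fin n → C)} (hV : IsDenseIn V X)
    {f : RatTuple k n m} {g : RatTuple k' m l}
    (h : IsDenseIn {x | x ∈ X ∧ x ∈ f.dom ∧ f.val x ∈ g.dom} X) :
    IsDenseIn {x | x ∈ V ∧ x ∈ f.dom ∧ f.val x ∈ g.dom} X := by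
  obtain ⟨q, hq⟩ := f.exists_comp_dom (C := C) g
  simp only [hq] at h ⊢
  exact hV.inter_ne_zero h

/-- A polynomial relation between the values of fractions holds wherever they are defined, if it
holds on a dense subset. -/
theorem IsDenseIn.eval_val_eq_zero {V X : Set (Fin n → C)} (hV : IsDenseIn V X)
    (f : RatTuple k n m) (P : MvPolynomial (Fin m) C)
    (h : ∀ x ∈ V, x ∈ f.dom → eval (f.val x) P = 0) {x : Fin n → C} (hx : x ∈ X)
    (hxf : x ∈ f.dom) : eval (f.val x) P = 0 := by
  obtain ⟨d, Q, hQ⟩ := f.exists_eval_eq_den_pow_mul P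
  have h0 := hV.2 (Q * MvPolynomial.map (algebraMap k C) f.den) (fun y hy => by
    rw [map_mul, ← aeval_eq_eval_map]
    by_cases hyf : y ∈ f.dom
    · rw [hQ y hyf, h y hy hyf, mul_zero, zero_mul]
    · rw [not_not.1 hyf, mul_zero]) x hx
  rw [map_mul, ← aeval_eq_eval_map, hQ x hxf] at h0
  have hne : aeval x f.den ≠ 0 := hxf
  simpa [hne] using h0

end

/-! ### Zariski closures of images -/

/-- The Zariski closure of a set of points. -/
def zariskiClosure (A : Set (Fin n → C)) : Set (Fin n → C) :=
  zeroLocus C (vanishingIdeal C A)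

theorem mem_zariskiClosure {A : Set (Fin n → C)} {y : Fin n → C} :
    y ∈ zariskiClosure A ↔
      ∀ P : MvPolynomial (Fin n) C, (∀ x ∈ A, eval x P = 0) → eval y P = 0 :=
  Iff.rfl

theorem subset_zariskiClosure (A : Set (Fin n → C)) : A ⊆ zariskiClosure A :=
  fun _ hx _ hP => hP _ hx

theorem isDenseIn_zariskiClosure (A : Set (Fin n → C)) : IsDenseIn A (zariskiClosure A) :=
  ⟨subset_zariskiClosure A, fun P hP _ hx => hx P hP⟩

theorem mem_vanishingIdeal_zariskiClosure {A : Set (Fin n → C)} {P : MvPolynomial (Fin n) C} :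
    P ∈ vanishingIdeal C (zariskiClosure A) ↔ ∀ x ∈ A, eval x P = 0 :=
  ⟨fun h x hx => h x (subset_zariskiClosure A hx), fun h _ hx => hx P h⟩

theorem isAlgebraicSet_zariskiClosure (A : Set (Fin n → C)) :
    IsAlgebraicSet (zariskiClosure A) :=
  ⟨_, rfl⟩

theorem IsAlgebraicSet.mem_of_eval_eq_zero {X : Set (Fin n → C)} (hX : IsAlgebraicSet X)
    {x : Fin n → C} (h : ∀ P ∈ vanishingIdeal C X, eval x P = 0) : x ∈ X := by
  obtain ⟨I, rfl⟩ := hX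
  exact fun P hP => h P fun y hy => hy P hP

/-- Polynomial maps are continuous: they map `zariskiClosure A` to any algebraic set to which they
map `A`. -/
theorem IsAlgebraicSet.aeval_mem_of_mem_zariskiClosure {k : Type*} [Field k] [Algebra k C]
    {X : Set (Fin n → C)} (hX : IsAlgebraicSet X) {A : Set (Fin m → C)}
    {p : Fin n → MvPolynomial (Fin m) k} (h : IsMorphism A X p) :
    IsMorphism (zariskiClosure A) X p := by
  intro y hy
  refine hX.mem_of_eval_eq_zero fun P hP => ?_
  have key : ∀ z : Fin m → C, eval z (bind₁ (fun i => MvPolynomial.map (algebraMap k C) (p i)) P) =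
      eval (fun i => aeval z (p i)) P := fun z => by
    simp only [aeval_eq_eval_map]
    exact eval₂Hom_bind₁ _ _ _ _
  rw [← key]
  exact mem_zariskiClosure.1 hy _ fun z hz => (key z).trans (hP _ (h z hz))

variable {k : Type*} [Field k] [Algebra k C]

theorem IsIrred.zariskiClosure_image {X : Set (Fin n → C)} (hX : IsIrred X) (f : RatTuple k n m)
    (hf : IsDenseIn (X ∩ f.dom) X) : IsIrred (zariskiClosure (f.val '' (X ∩ f.dom))) := by
  -- `P ∘ f` vanishes if and only if its numerator does.
  have key : ∀ P : MvPolynomial (Fin m) C, ∃ Q : MvPolynomial (Fin n) C,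
      ∀ x ∈ f.dom, eval x Q = 0 ↔ eval (f.val x) P = 0 := fun P => by
    obtain ⟨d, Q, hQ⟩ := f.exists_eval_eq_den_pow_mul P
    refine ⟨Q, fun x hx => ?_⟩
    have hne : aeval x f.den ≠ 0 := hx
    simp [hQ x hx, hne]
  refine ⟨fun h => ?_, fun {P Q} hPQ => ?_⟩
  · refine hX.ne_top ((Ideal.eq_top_iff_one _).2 (hf.2 1 fun x hx => ?_))
    have h1 := mem_vanishingIdeal_zariskiClosure.1 ((Ideal.eq_top_iff_one _).1 h) _
      (Set.mem_image_of_mem _ hx)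
    simp at h1
  · obtain ⟨P', hP'⟩ := key P
    obtain ⟨Q', hQ'⟩ := key Q
    simp only [mem_vanishingIdeal_zariskiClosure, Set.forall_mem_image] at hPQ ⊢
    refine (hX.mem_or_mem (x := P') (y := Q') (hf.2 _ fun x hx => ?_)).imp ?_ ?_
    · rw [map_mul, mul_eq_zero, hP' x hx.2, hQ' x hx.2, ← mul_eq_zero, ← map_mul]
      exact hPQ hx
    · exact fun h x hx => (hP' x hx.2).1 (h x hx.1)
    · exact fun h x hx => (hQ' x hx.2).1 (h x hx.1)

theorem RatTuple.val_ofPoly (p : Fin m → MvPolynomial (Fin n) k) (x : Fin n → C) :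
    (RatTuple.ofPoly p).val x = fun j => aeval x (p j) := by
  ext j
  simp [RatTuple.val, RatTuple.ofPoly]

theorem RatTuple.mem_dom_ofPoly (p : Fin m → MvPolynomial (Fin n) k) (x : Fin n → C) :
    x ∈ (RatTuple.ofPoly p).dom := by
  simp [RatTuple.dom, RatTuple.ofPoly]

theorem RatTuple.val_id (x : Fin n → C) : (RatTuple.id k n).val x = x := by
  simp [RatTuple.id, RatTuple.val_ofPoly]

/-- A rational map with a polynomial left inverse is birational onto the closure of its image. -/
theorem isBirational_zariskiClosure_image {X : Set (Fin n → C)} (hX : IsAlgebraicSet X)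
    (f : RatTuple k n m) (hf : IsDenseIn (X ∩ f.dom) X) (p : Fin n → MvPolynomial (Fin m) k)
    (hp : ∀ x ∈ X, x ∈ f.dom → (fun i => aeval (f.val x) (p i)) = x) :
    IsBirational X (zariskiClosure (f.val '' (X ∩ f.dom))) f := by
  refine ⟨⟨hf, fun x hx => subset_zariskiClosure _ (Set.mem_image_of_mem _ hx)⟩,
    RatTuple.ofPoly p, ⟨?_, fun y hy => ?_⟩, ⟨?_, fun x hx hxf _ _ => ?_⟩, ?_, ?_⟩
  · exact (isDenseIn_self _).mono (fun y hy => ⟨hy, RatTuple.mem_dom_ofPoly _ _⟩) fun y hy => hy.1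
  · rw [RatTuple.val_ofPoly]
    refine hX.aeval_mem_of_mem_zariskiClosure (k := k) (fun z hz => ?_) y hy.1
    obtain ⟨x, hx, rfl⟩ := hz
    rw [hp x hx.1 hx.2]
    exact hx.1
  · exact hf.mono (fun x hx => ⟨hx.1, hx.2, RatTuple.mem_dom_ofPoly _ _⟩) fun x hx => hx.1
  · rw [RatTuple.val_id, RatTuple.val_ofPoly, hp x hx hxf]
  · refine (isDenseIn_zariskiClosure _).mono ?_ fun y hy => hy.1
    rintro _ ⟨x, hx, rfl⟩
    refine ⟨subset_zariskiClosure _ (Set.mem_image_of_mem _ hx), RatTuple.mem_dom_ofPoly _ _, ?_⟩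
    rw [RatTuple.val_ofPoly, hp x hx.1 hx.2]
    exact hx.2
  · intro y hy _ hyf _
    rw [RatTuple.val_id]
    rw [RatTuple.val_ofPoly] at hyf ⊢
    ext j
    -- The relation `f (p y) = y`, with denominators cleared, holds on the image of `f`.
    let q : MvPolynomial (Fin m) k := bind₁ p (f.num j) - MvPolynomial.X j * bind₁ p f.den
    have hq : ∀ z : Fin m → C, eval z (MvPolynomial.map (algebraMap k C) q) =
        aeval (fun i => aeval z (p i)) (f.num j) -
          z j * aeval (fun i => aeval z (p i)) f.den := fun z => by
      rw [← aeval_eq_eval_map]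
      simp only [q, map_sub, map_mul, aeval_X, aeval_bind₁]
    have h0 := mem_zariskiClosure.1 hy (MvPolynomial.map (algebraMap k C) q) (by
      rintro _ ⟨x, hx, rfl⟩
      have hne : aeval x f.den ≠ 0 := hx.2
      rw [hq, hp x hx.1 hx.2, RatTuple.val,
        div_mul_cancel₀ _ hne, sub_self])
    rw [hq, sub_eq_zero] at h0
    rw [RatTuple.val, eq_comm, div_eq_iff hyf, h0]

end Density

/-! ### Conjugation and fields of definition -/

section Conjugation

variable {K L C : Type*} [Field K] [Field L] [Field C] [Algebra K L] [Algebra K C] [Algebra L C]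
  [IsScalarTower K L C] {n m : ℕ}

theorem aeval_comp_map_restrictNormal [Normal K L] (s : C ≃ₐ[K] C) (x : Fin n → C)
    (p : MvPolynomial (Fin n) L) :
    aeval (fun i => s (x i)) (MvPolynomial.map ((s.restrictNormal L : L ≃ₐ[K] L) : L →+* L) p) =
      s (aeval x p) := by
  have h : (algebraMap L C).comp ((s.restrictNormal L : L ≃ₐ[K] L) : L →+* L) =
      (s : C →+* C).comp (algebraMap L C) :=
    RingHom.ext fun a => s.restrictNormal_commutes L a
  rw [aeval_def, eval₂_map, h, aeval_def]
  exact (hom_eval₂ p (algebraMap L C) (s : C →+* C) x).symm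

/-- If `X` is defined over `L` and `s` is an automorphism of `C` over `K` that induces `σ` on `L`,
then `X^σ ⊆ s(X)`. -/
theorem symm_comp_mem_of_mem_conjVariety [Normal K L] {X : Set (Fin n → C)}
    (hX : IsVarietyOver L X) (s : C ≃ₐ[K] C) {y : Fin n → C}
    (hy : y ∈ conjVariety (s.restrictNormal L) X) : (fun i => s.symm (y i)) ∈ X := by
  obtain ⟨hXa, S, hS⟩ := hX
  have hSX : ∀ p ∈ S, ∀ x ∈ X, aeval x p = 0 := fun p hp x hx => by
    have h : MvPolynomial.map (algebraMap L C) p ∈ vanishingIdeal C X :=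
      hS ▸ Ideal.subset_span (Set.mem_image_of_mem _ hp)
    rw [aeval_eq_eval_map]
    exact h x hx
  have hker : vanishingIdeal C X ≤ RingHom.ker (eval fun i => s.symm (y i)) := by
    rw [hS, Ideal.span_le]
    rintro _ ⟨p, hp, rfl⟩
    rw [SetLike.mem_coe, RingHom.mem_ker, ← aeval_eq_eval_map]
    apply s.injective
    rw [← aeval_comp_map_restrictNormal, map_zero]
    simpa using hy p (hSX p hp)
  exact hXa.mem_of_eval_eq_zero fun P hP => hker hP

/-- If `R = R^σ ∘ f_σ` for all `σ`, then the closed image of `R` is defined over `K`: its ideal is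
stable under `Gal(C/K)`, since `R(x) = s(R(y))` for a generic point `x`, where `s` induces `σ` on
`L` and `f_σ(x) = s(y)`. -/
theorem isDefinedOver_zariskiClosure_image [IsGalois K C] [Normal K L] {X : Set (Fin n → C)}
    (hX : IsVarietyOver L X) (R : RatTuple L n m) {f : (L ≃ₐ[K] L) → RatTuple L n n}
    (hfX : ∀ σ, ∀ x ∈ X ∩ (f σ).dom, (f σ).val x ∈ conjVariety σ X)
    (hRf : ∀ σ, EqComp X R (R.conj σ) (f σ)) :
    IsDefinedOver K (zariskiClosure (R.val '' (X ∩ R.dom))) := by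
  refine ⟨_, eq_span_of_galois_stable _ fun s P hP => ?_⟩
  simp only [mem_vanishingIdeal_zariskiClosure, Set.forall_mem_image] at hP ⊢
  rintro x ⟨hx, hxR⟩
  set σ := s.restrictNormal L
  refine IsDenseIn.eval_val_eq_zero (hRf σ).1 R _ (fun x hx' hxR => ?_) hx hxR
  obtain ⟨hx, hxf, hfR⟩ := hx'
  -- The point `f_σ(x)` is `s(y)` with `y ∈ X`, so that `R(x) = R^σ(s(y)) = s(R(y))`.
  obtain ⟨y, hy, hyx⟩ : ∃ y ∈ X, (fun i => s (y i)) = (f σ).val x :=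
    ⟨_, symm_comp_mem_of_mem_conjVariety hX s (hfX σ x ⟨hx, hxf⟩), by simp⟩
  rw [(hRf σ).2 x hx hxf hfR hxR]
  rw [← hyx] at hfR ⊢
  have hyR : y ∈ R.dom := fun h => hfR (by
    rw [RatTuple.conj, aeval_comp_map_restrictNormal, h, map_zero])
  have hval : (R.conj σ).val (fun i => s (y i)) = fun j => s (R.val y j) := by
    ext j
    simp only [RatTuple.val, RatTuple.conj, σ, aeval_comp_map_restrictNormal, map_div₀]
  rw [hval]
  have h := eval₂_comp_left (s : C →+* C) (RingHom.id C) (R.val y) P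
  rw [eval_map]
  refine h.symm.trans ?_
  rw [show eval₂ (RingHom.id C) (R.val y) P = eval (R.val y) P from rfl, hP ⟨hy, hyR⟩, map_zero]

end Conjugation

/-! ### Linear combinations of fractions with a common denominator -/

namespace RatTuple

variable {L C : Type*} [Field L] [Field C] [Algebra L C] {n l m N : ℕ}
  {ι κ : Type*} [Fintype ι] [DecidableEq ι]

/-- The tuple of the linear combinations `∑ τ, a k τ * (g τ)ᵢ`, for all `i` and `k`, together with
the polynomials `p j`, brought to the common denominator `∏ τ, (g τ).den`. The components are
numbered by `e`. -/
noncomputable def linComb (e : (Fin l × κ) ⊕ Fin m ≃ Fin N) (a : κ → ι → L)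
    (g : ι → RatTuple L n l) (p : Fin m → MvPolynomial (Fin n) L) : RatTuple L n N where
  num j := Sum.elim
    (fun ik : Fin l × κ => ∑ τ, MvPolynomial.C (a ik.2 τ) * (g τ).num ik.1 *
      ∏ τ' ∈ Finset.univ.erase τ, (g τ').den)
    (fun j => p j * ∏ τ, (g τ).den) (e.symm j)
  den := ∏ τ, (g τ).den

variable (e : (Fin l × κ) ⊕ Fin m ≃ Fin N) (a : κ → ι → L) (g : ι → RatTuple L n l)
  (p : Fin m → MvPolynomial (Fin n) L)

theorem mem_dom_linComb {x : Fin n → C} :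
    x ∈ (linComb e a g p).dom ↔ ∀ τ, x ∈ (g τ).dom := by
  simp [dom, linComb, Finset.prod_eq_zero_iff]

theorem val_linComb_inl {x : Fin n → C} (hx : x ∈ (linComb e a g p).dom) (i : Fin l) (k : κ) :
    (linComb e a g p).val x (e (Sum.inl (i, k))) =
      ∑ τ, algebraMap L C (a k τ) * (g τ).val x i := by
  have hx' : ∀ τ, aeval x (g τ).den ≠ 0 := (mem_dom_linComb e a g p).1 hx
  have hne : aeval x (∏ τ, (g τ).den) ≠ 0 := hx
  simp only [val, linComb, Equiv.symm_apply_apply, Sum.elim_inl]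
  rw [div_eq_iff hne, Finset.sum_mul, map_sum]
  refine Finset.sum_congr rfl fun τ _ => ?_
  rw [← Finset.mul_prod_erase _ _ (Finset.mem_univ τ)]
  simp only [map_mul, aeval_C]
  field_simp [hx' τ]

theorem val_linComb_inr {x : Fin n → C} (hx : x ∈ (linComb e a g p).dom) (j : Fin m) :
    (linComb e a g p).val x (e (Sum.inr j)) = aeval x (p j) := by
  have hne : aeval x (∏ τ, (g τ).den) ≠ 0 := hx
  simp only [val, linComb, Equiv.symm_apply_apply, Sum.elim_inr]
  rw [div_eq_iff hne, map_mul]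

theorem conj_linComb {K : Type*} [Field K] [Algebra K L] (σ : L ≃ₐ[K] L) :
    (linComb e a g p).conj σ = linComb e (fun k τ => σ (a k τ)) (fun τ => (g τ).conj σ)
      (fun j => MvPolynomial.map (σ : L →+* L) (p j)) := by
  simp only [conj, linComb, map_prod, RatTuple.mk.injEq, and_true]
  ext1 j
  rcases e.symm j with ik | j <;> simp [map_sum, map_prod]

end RatTuple

/-! ### The descent -/

section Descent

variable {K L C : Type*} [Field K] [Field L] [Field C] [Algebra K L] [Algebra L C] {n m : ℕ}

theorem conj_one (g : RatTuple L n m) :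
    g.conj (1 : L ≃ₐ[K] L) = g := by
  have h : ((1 : L ≃ₐ[K] L) : L →+* L) = RingHom.id L := rfl
  simp only [RatTuple.conj, h, MvPolynomial.map_id]

theorem conj_ofPoly (σ : L ≃ₐ[K] L) (p : Fin m → MvPolynomial (Fin n) L) :
    (RatTuple.ofPoly p).conj σ =
      RatTuple.ofPoly fun j => MvPolynomial.map (σ : L →+* L) (p j) := by
  simp only [RatTuple.conj, RatTuple.ofPoly, map_one]

/-- In a descent datum `f₁` is the identity: it is idempotent and generically invertible. -/
theorem IsDescentDatum.val_one [Algebra K C] [IsScalarTower K L C] [Normal K L]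
    {X : Set (Fin n → C)} (hX : IsVarietyOver L X)
    {φ : Fin m → MvPolynomial (Fin n) L} {f : (L ≃ₐ[K] L) → RatTuple L n n}
    (hf : IsDescentDatum X φ f) {x : Fin n → C} (hx : x ∈ X) (hxf : x ∈ (f 1).dom) :
    (f 1).val x = x := by
  obtain ⟨⟨-, hfX⟩, g, -, ⟨hgd, hg⟩, -⟩ := hf.birational 1
  have hX1 : ∀ y ∈ conjVariety (1 : L ≃ₐ[K] L) X, y ∈ X := fun y hy => by
    have h1 : (AlgEquiv.refl : C ≃ₐ[K] C).restrictNormal L = 1 :=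
      AlgEquiv.ext fun a => (algebraMap L C).injective
        ((AlgEquiv.refl : C ≃ₐ[K] C).restrictNormal_commutes L a)
    exact symm_comp_mem_of_mem_conjVariety (K := K) hX AlgEquiv.refl (h1 ▸ hy)
  obtain ⟨hcd, hc⟩ := hf.cocycle 1 1
  rw [conj_one] at hcd hc
  have hV := hcd.inter_comp_dom hgd
  have hdense : ∀ x ∈ X, x ∈ (f 1).dom → (f 1).val x ∈ (f 1).dom → (f 1).val x ∈ g.dom →
      (f 1).val x = x := fun x hx h1 h2 h3 => by
    have hidem : (f 1).val ((f 1).val x) = (f 1).val x := by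
      rw [← hc x hx h1 h2 (by rwa [mul_one]), mul_one]
    have e1 := hg x hx h1 h3 (RatTuple.mem_dom_ofPoly _ _)
    have e2 := hg _ (hX1 _ (hfX x ⟨hx, h1⟩)) h2 (by rwa [hidem]) (RatTuple.mem_dom_ofPoly _ _)
    rw [RatTuple.val_id] at e1 e2
    rw [e2, hidem, ← e1]
  ext i
  -- The relation `num i = z i * den` between polynomials extends from a dense subset to `X`.
  have h0 := hV.2 (MvPolynomial.map (algebraMap L C) ((f 1).num i - MvPolynomial.X i * (f 1).den))
    (fun y hy => by
      have hne : aeval y (f 1).den ≠ 0 := hy.2.1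
      have h := congrFun (hdense y hy.1.1 hy.1.2.1 hy.1.2.2 hy.2.2) i
      rw [RatTuple.val, div_eq_iff hne] at h
      rw [← aeval_eq_eval_map, map_sub, map_mul, aeval_X, h, sub_self]) x hx
  rw [← aeval_eq_eval_map, map_sub, map_mul, aeval_X, sub_eq_zero] at h0
  have hne : aeval x (f 1).den ≠ 0 := hxf
  rw [RatTuple.val, div_eq_iff hne, h0]

/-- The twisted traces `∑ τ, τ (b k) * (f_τ)ᵢ` of the coordinate functions, together with `φ`, are
invariant under the semilinear action `u ↦ u^σ ∘ f_σ`. -/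
theorem IsDescentDatum.eqComp_linComb [FiniteDimensional K L] [DecidableEq (L ≃ₐ[K] L)] {N : ℕ}
    {κ : Type*} {X : Set (Fin n → C)} {φ : Fin m → MvPolynomial (Fin n) L}
    {f : (L ≃ₐ[K] L) → RatTuple L n n} (hf : IsDescentDatum X φ f)
    (e : (Fin n × κ) ⊕ Fin m ≃ Fin N) (b : κ → L) (σ : L ≃ₐ[K] L) :
    EqComp X (RatTuple.linComb e (fun k τ => τ (b k)) f φ)
      ((RatTuple.linComb e (fun k τ => τ (b k)) f φ).conj σ) (f σ) := by
  rw [RatTuple.conj_linComb]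
  refine ⟨?_, fun x hx hxf hfR hxR => ?_⟩
  · simp only [RatTuple.mem_dom_linComb]
    choose q hq using fun τ => (f σ).exists_comp_dom (C := C) ((f τ).conj σ)
    have h := isDenseIn_forall_ne_zero (q := q) (X := X) fun τ => by
      simpa only [← hq] using (hf.cocycle σ τ).1
    simp only [← hq] at h
    exact h.mono (fun x hx => ⟨hx.1, (hx.2 1).1, fun τ => (hx.2 τ).2⟩) fun x hx => hx.1
  · ext j
    obtain ⟨j, rfl⟩ := e.surjective j
    rcases j with ⟨i, k⟩ | j
    · rw [RatTuple.val_linComb_inl _ _ _ _ hxR, RatTuple.val_linComb_inl _ _ _ _ hfR,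
        ← Equiv.sum_comp (Equiv.mulLeft σ)]
      rw [RatTuple.mem_dom_linComb] at hfR hxR
      refine Finset.sum_congr rfl fun τ _ => ?_
      rw [Equiv.coe_mulLeft, AlgEquiv.mul_apply,
        (hf.cocycle σ τ).2 x hx hxf (hfR τ) (hxR (σ * τ))]
    · rw [RatTuple.val_linComb_inr _ _ _ _ hxR, RatTuple.val_linComb_inr _ _ _ _ hfR]
      have h := (hf.compat σ).2
      rw [conj_ofPoly] at h
      have h := h x hx hxf (RatTuple.mem_dom_ofPoly _ _) (RatTuple.mem_dom_ofPoly _ _)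
      rw [RatTuple.val_ofPoly, RatTuple.val_ofPoly] at h
      exact congrFun h j

end Descent

end WeilDescent

theorem mainTheorem2
    {K L C : Type*} [Field K] [PerfectField K] [Field L] [Field C]
    [Algebra K L] [Algebra K C] [Algebra L C] [IsScalarTower K L C]
    [IsAlgClosure K C] [FiniteDimensional K L] [IsGalois K L]
    {n m : ℕ} (X : Set (Fin n → C)) (hX : WeilDescent.IsVarietyOver L X)
    (Z : Set (Fin m → C)) (hZ : WeilDescent.IsVarietyOver K Z)
    (φ : Fin m → MvPolynomial (Fin n) L) (hφ : WeilDescent.IsMorphism X Z φ)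
    (f : (L ≃ₐ[K] L) → WeilDescent.RatTuple L n n)
    (hf : WeilDescent.IsDescentDatum X φ f) :
    ∃ (N : ℕ) (Y : Set (Fin N → C)) (Λ : Fin m → MvPolynomial (Fin N) K)
      (R : WeilDescent.RatTuple L n N),
      WeilDescent.IsVarietyOver K Y ∧
      (WeilDescent.IsIrred X → WeilDescent.IsIrred Y) ∧
      WeilDescent.IsMorphism Y Z Λ ∧
      WeilDescent.IsBirational X Y R ∧
      WeilDescent.EqComp X (WeilDescent.RatTuple.ofPoly φ) (WeilDescent.RatTuple.ofPoly Λ) R ∧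
      ∀ σ : L ≃ₐ[K] L, WeilDescent.EqComp X R (R.conj σ) (f σ) := by
  classical
  open WeilDescent in
  have : IsAlgClosed C := IsAlgClosure.isAlgClosed K
  have : IsGalois K C := { }
  let b := Module.finBasis K L
  let e := Fintype.equivFin ((Fin n × Fin (Module.finrank K L)) ⊕ Fin m)
  let R := RatTuple.linComb e (fun k (τ : L ≃ₐ[K] L) => τ (b k)) f φ
  have hdom : ∀ x : Fin n → C, x ∈ R.dom ↔ ∀ τ, x ∈ (f τ).dom := fun x =>
    RatTuple.mem_dom_linComb _ _ _ _
  have hRd : IsDenseIn (X ∩ R.dom) X := by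
    have h := isDenseIn_forall_ne_zero (X := X)
      (q := fun τ => MvPolynomial.map (algebraMap L C) (f τ).den) fun τ => by
        simp only [← aeval_eq_eval_map]
        exact (hf.birational τ).1.1
    simp only [← aeval_eq_eval_map] at h
    exact h.mono (fun x hx => ⟨hx.1, (hdom x).2 hx.2⟩) fun x hx => hx.1
  have hRf : ∀ σ, EqComp X R (R.conj σ) (f σ) := hf.eqComp_linComb e b
  have hRφ : ∀ x ∈ X ∩ R.dom,
      (fun j => MvPolynomial.aeval (R.val x) (MvPolynomial.X (e (Sum.inr j)) :
        MvPolynomial (Fin _) K)) = fun j => MvPolynomial.aeval x (φ j) := fun x hx => by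
    ext j
    rw [MvPolynomial.aeval_X]
    exact RatTuple.val_linComb_inr _ _ _ _ hx.2 j
  refine ⟨_, zariskiClosure (R.val '' (X ∩ R.dom)), fun j => MvPolynomial.X (e (Sum.inr j)), R,
    ⟨isAlgebraicSet_zariskiClosure _, isDefinedOver_zariskiClosure_image hX R
      (fun σ => (hf.birational σ).1.2) hRf⟩, fun h => h.zariskiClosure_image R hRd,
    hZ.1.aeval_mem_of_mem_zariskiClosure (k := K) ?_, ?_, ⟨?_, ?_⟩, hRf⟩
  · rintro _ ⟨x, hx, rfl⟩
    rw [hRφ x hx]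
    exact hφ x hx.1
  · -- The coordinate `zᵢ = (f₁)ᵢ` is the combination of its twisted traces with the coefficients
    -- given by the trace dual basis.
    refine isBirational_zariskiClosure_image hX.1 R hRd (fun i => ∑ k,
      MvPolynomial.C (b.traceDual k) * MvPolynomial.X (e (Sum.inl (i, k)))) fun x hx hxR => ?_
    ext i
    simp only [map_sum, map_mul, MvPolynomial.aeval_C, MvPolynomial.aeval_X]
    simp only [R, RatTuple.val_linComb_inl _ _ _ _ hxR, Finset.mul_sum, ← mul_assoc, ← map_mul]
    rw [Finset.sum_comm]
    simp only [← Finset.sum_mul, ← map_sum, sum_traceDual_mul_conj]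
    simp [hf.val_one hX hx ((hdom x).1 hxR 1)]
  · exact hRd.mono (fun x hx => ⟨hx.1, hx.2, RatTuple.mem_dom_ofPoly _ _⟩) fun x hx => hx.1
  · intro x hx hxR _ _
    rw [RatTuple.val_ofPoly, RatTuple.val_ofPoly, hRφ x ⟨hx, hxR⟩]
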